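/- Language and systems. Let $L$ be the first-order language whose only predicate symbol is $=$, with a function symbol for every primitive recursive function (one for each definition from $0$, successor $S$ and projections by composition and primitive recursion), and with the primitive connectives $\wedge,\vee,\to,\neg,\forall,\exists$; $A\leftrightarrow B$ abbreviates $(A\to B)\wedge(B\to A)$. $\mathrm{IQC}$ is intuitionistic first-order predicate logic in $L$. Heyting arithmetic $\mathrm{HA}$ is $\mathrm{IQC}$ with the equality axioms, the defining equations of all primitive recursive function symbols, $\forall n\,\neg S(n)=0$, $\forall n\forall m\,(S(n)=S(m)\to n=m)$, and the induction scheme $B[0]\wedge\forall n(B[n]\to B[S(n)])\to\forall n\,B[n]$ for every $L$-formula $B$. Axioms and instances of schemes may contain free variables and then stand for their universal closures. Bounded quantifiers $\forall n<t.\,A$ and $\exists n<t.\,A$ (with $n$ not in $t$) abbreviate $\forall n(f(n,t)=1\to A)$ and $\exists n(f(n,t)=1\wedge A)$, where $f$ is the symbol for the characteristic function of $<$, $f(n,t)=\mathrm{sg}(t\mathbin{\dot-}n)$. Formula classes. For $k\ge 0$, a $\Sigma^0_k$-formula is a formula $\exists n_1\forall n_2\exists n_3\cdots Q n_k.\,P$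 and a $\Pi^0_k$-formula is a formula $\forall n_1\exists n_2\forall n_3\cdots Q' n_k.\,P$, each with exactly $k$ alternating quantifiers in front of a formula $P$ all of whose quantifiers are bounded; $P$ may contain further free variables. Dual. The dual $A^\perp$ of a formula is defined by: $A^\perp=\neg A$ for $A$ prime; $(\neg B)^\perp=B$; $(B\vee C)^\perp=B^\perp\wedge C^\perp$; $(B\wedge C)^\perp=B^\perp\vee C^\perp$; $(B\to C)^\perp=B\wedge C^\perp$; $(\forall n\,B)^\perp=\exists n\,B^\perp$; $(\exists n\,B)^\perp=\forall n\,B^\perp$. Schemes. For a class $\Gamma$ of formulas, $\Gamma$-$\mathbf{LEM}$ is the scheme $A\vee\neg A$ and $\Gamma$-$\mathbf{DNE}$ is the scheme $\neg\neg A\to A$, for all $A\in\Gamma$. $\Delta^0_k$-$\mathbf{LEM}$ is the scheme $(A\leftrightarrow B)\to(A\vee\neg A)$, and $\mathsf{fp}\Delta^0_k$-$\mathbf{LEM}$ is the scheme $(A\leftrightarrow B)\to(B\vee A^\perp)$, for all $\Pi^0_k$-formulas $A$ and all $\Sigma^0_k$-formulas $B$. A scheme $X$ proves a scheme $Y$ in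 $\mathrm{HA}$ (respectively, intuitionistically) if every instance of $Y$ is derivable in $\mathrm{HA}+X$ (respectively, in $\mathrm{IQC}+X$). Theorem. For every $k\ge 0$: (1) $\Sigma^0_k$-$\mathbf{LEM}$ proves $\Pi^0_k$-$\mathbf{LEM}$ in $\mathrm{HA}$. (2) $\Sigma^0_{k+1}$-$\mathbf{DNE}$ proves $\Sigma^0_k$-$\mathbf{LEM}$ in $\mathrm{HA}$. (3) $\Sigma^0_k$-$\mathbf{LEM}$ intuitionistically proves $\Sigma^0_k$-$\mathbf{DNE}$. (4) $\Pi^0_{k+1}$-$\mathbf{LEM}$ intuitionistically proves $\Sigma^0_k$-$\mathbf{LEM}$. (5) $\mathsf{fp}\Delta^0_k$-$\mathbf{LEM}$ is equivalent in $\mathrm{HA}$ to $\Sigma^0_k$-$\mathbf{DNE}$, that is, each proves the other in $\mathrm{HA}$. (6) $\Sigma^0_k$-$\mathbf{DNE}$ proves $\Delta^0_k$-$\mathbf{LEM}$ in $\mathrm{HA}$. -/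

import Mathlib

/-! Intuitionistic first-order arithmetic in the language of primitive recursive functions, with
de Bruijn indices for variables. -/

namespace HeytingArith

/-- Symbols of arity `n` for primitive recursive functions: one symbol for each definition from
zero, successor and projections by composition and primitive recursion. -/
inductive PRSym : ℕ → Type
  | zero : PRSym 0
  | succ : PRSym 1
  | proj {n : ℕ} (i : Fin n) : PRSym n
  | comp {m n : ℕ} (f : PRSym m) (g : Fin m → PRSym n) : PRSym n
  | prec {n : ℕ} (f : PRSym n) (g : PRSym (n + 2)) : PRSym (n + 1)

/-- The first-order language of primitive recursive arithmetic. Equality is the only predicate;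
it is a constructor of `Formula` below. -/
def LPra : FirstOrder.Language where
  Functions := PRSym
  Relations := fun _ => Empty

/-- Terms; the variables are de Bruijn indices. -/
abbrev PTerm : Type := LPra.Term ℕ

/-- The term `f(t₁, …, tₙ)`. -/
def app {n : ℕ} (f : PRSym n) (ts : Fin n → PTerm) : PTerm :=
  FirstOrder.Language.Term.func (L := LPra) f ts

def var (i : ℕ) : PTerm := FirstOrder.Language.Term.var i

def zeroT : PTerm := app PRSym.zero ![]

def succT (t : PTerm) : PTerm := app PRSym.succ ![t]

/-- All variables of `t` raised by one (for use under one more quantifier). -/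
def liftT (t : PTerm) : PTerm := t.relabel Nat.succ

/-- Formulas, with the primitive connectives `=`, `∧`, `∨`, `→`, `¬`, `∀`, `∃`. The quantifiers
bind the variable with index `0` of their body. -/
inductive Formula : Type
  | eq (s t : PTerm) : Formula
  | and (A B : Formula) : Formula
  | or (A B : Formula) : Formula
  | imp (A B : Formula) : Formula
  | neg (A : Formula) : Formula
  | all (A : Formula) : Formula
  | ex (A : Formula) : Formula

namespace Formula

/-- `A ↔ B` abbreviates `(A → B) ∧ (B → A)`. -/
def iff (A B : Formula) : Formula := and (imp A B) (imp B A)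

/-- The substitution `σ`, moved under one quantifier. -/
def up (σ : ℕ → PTerm) : ℕ → PTerm
  | 0 => var 0
  | i + 1 => liftT (σ i)

/-- Simultaneous capture-avoiding substitution of terms for the free variables. -/
def subst : (ℕ → PTerm) → Formula → Formula
  | σ, eq s t => eq (FirstOrder.Language.Term.subst s σ) (FirstOrder.Language.Term.subst t σ)
  | σ, and A B => and (subst σ A) (subst σ B)
  | σ, or A B => or (subst σ A) (subst σ B)
  | σ, imp A B => imp (subst σ A) (subst σ B)
  | σ, neg A => neg (subst σ A)
  | σ, all A => all (subst (up σ) A)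
  | σ, ex A => ex (subst (up σ) A)

/-- All free variables raised by one. -/
def lift (A : Formula) : Formula := subst (fun i => var (i + 1)) A

/-- `A[t]`: the term `t` replaces the variable `0`, all other variables are lowered by one. -/
def inst (A : Formula) (t : PTerm) : Formula :=
  subst (fun i => match i with
    | 0 => t
    | j + 1 => var j) A

/-- `A[S(n)]` where `n` is the variable `0`; no other variable changes. -/
def stepUp (A : Formula) : Formula :=
  subst (fun i => match i with
    | 0 => succT (var 0)
    | j + 1 => var (j + 1)) A

/-- The dual `A^⊥`. -/
def dual : Formula → Formula
  | eq s t => neg (eq s t)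
  | neg B => B
  | or B C => and (dual B) (dual C)
  | and B C => or (dual B) (dual C)
  | imp B C => and B (dual C)
  | all B => ex (dual B)
  | ex B => all (dual B)

end Formula

/-- Natural deduction for intuitionistic predicate logic: `Derives T Γ A` says that `A` is
derivable from the open assumptions `Γ` with the non-logical axioms `T`. The eigenvariable
condition concerns `Γ` only, so an axiom with free variables stands for its universal closure. -/
inductive Derives (T : Set Formula) : List Formula → Formula → Prop
  | ax {Γ : List Formula} {A : Formula} : A ∈ T → Derives T Γ A
  | hyp {Γ : List Formula} {A : Formula} : A ∈ Γ → Derives T Γ A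
  | andI {Γ : List Formula} {A B : Formula} :
      Derives T Γ A → Derives T Γ B → Derives T Γ (Formula.and A B)
  | andE₁ {Γ : List Formula} {A B : Formula} : Derives T Γ (Formula.and A B) → Derives T Γ A
  | andE₂ {Γ : List Formula} {A B : Formula} : Derives T Γ (Formula.and A B) → Derives T Γ B
  | orI₁ {Γ : List Formula} {A B : Formula} : Derives T Γ A → Derives T Γ (Formula.or A B)
  | orI₂ {Γ : List Formula} {A B : Formula} : Derives T Γ B → Derives T Γ (Formula.or A B)
  | orE {Γ : List Formula} {A B C : Formula} : Derives T Γ (Formula.or A B) →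
      Derives T (A :: Γ) C → Derives T (B :: Γ) C → Derives T Γ C
  | impI {Γ : List Formula} {A B : Formula} :
      Derives T (A :: Γ) B → Derives T Γ (Formula.imp A B)
  | impE {Γ : List Formula} {A B : Formula} :
      Derives T Γ (Formula.imp A B) → Derives T Γ A → Derives T Γ B
  | negI {Γ : List Formula} {A B : Formula} :
      Derives T (A :: Γ) B → Derives T (A :: Γ) (Formula.neg B) → Derives T Γ (Formula.neg A)
  | negE {Γ : List Formula} {A B : Formula} :
      Derives T Γ A → Derives T Γ (Formula.neg A) → Derives T Γ B
  | allI {Γ : List Formula} {A : Formula} :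
      Derives T (Γ.map Formula.lift) A → Derives T Γ (Formula.all A)
  | allE {Γ : List Formula} {A : Formula} (t : PTerm) :
      Derives T Γ (Formula.all A) → Derives T Γ (A.inst t)
  | exI {Γ : List Formula} {A : Formula} (t : PTerm) :
      Derives T Γ (A.inst t) → Derives T Γ (Formula.ex A)
  | exE {Γ : List Formula} {A B : Formula} : Derives T Γ (Formula.ex A) →
      Derives T (A :: Γ.map Formula.lift) B.lift → Derives T Γ B

/-- Every formula of `S` is derivable by pure intuitionistic logic from the axioms `T`. -/
def Proves (T S : Set Formula) : Prop := ∀ A ∈ S, Derives T [] A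

/-- The axioms of Heyting arithmetic: equality, the defining equations of the primitive recursive
functions, the two Peano axioms for the successor, and induction for all formulas. -/
inductive HAAxiom : Formula → Prop
  | eqRefl (t : PTerm) : HAAxiom (Formula.eq t t)
  | eqSubst (s t : PTerm) (A : Formula) :
      HAAxiom (Formula.imp (Formula.eq s t) (Formula.imp (A.inst s) (A.inst t)))
  | projDef {n : ℕ} (i : Fin n) (ts : Fin n → PTerm) :
      HAAxiom (Formula.eq (app (PRSym.proj i) ts) (ts i))
  | compDef {m n : ℕ} (f : PRSym m) (g : Fin m → PRSym n) (ts : Fin n → PTerm) :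
      HAAxiom (Formula.eq (app (PRSym.comp f g) ts) (app f (fun j => app (g j) ts)))
  | precZero {n : ℕ} (f : PRSym n) (g : PRSym (n + 2)) (ts : Fin n → PTerm) :
      HAAxiom (Formula.eq (app (PRSym.prec f g) (Fin.cons zeroT ts)) (app f ts))
  | precSucc {n : ℕ} (f : PRSym n) (g : PRSym (n + 2)) (s : PTerm) (ts : Fin n → PTerm) :
      HAAxiom (Formula.eq (app (PRSym.prec f g) (Fin.cons (succT s) ts))
        (app g (Fin.cons s (Fin.cons (app (PRSym.prec f g) (Fin.cons s ts)) ts))))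
  | succNeZero : HAAxiom (Formula.all (Formula.neg (Formula.eq (succT (var 0)) zeroT)))
  | succInj : HAAxiom (Formula.all (Formula.all (Formula.imp
      (Formula.eq (succT (var 1)) (succT (var 0))) (Formula.eq (var 1) (var 0)))))
  | induction (B : Formula) : HAAxiom (Formula.imp
      (Formula.and (B.inst zeroT) (Formula.all (Formula.imp B B.stepUp))) (Formula.all B))

/-- Heyting arithmetic. -/
def HA : Set Formula := {A | HAAxiom A}

/-- Predecessor. -/
def predSym : PRSym 1 := PRSym.prec PRSym.zero (PRSym.proj 0)

/-- `(n, t) ↦ t ∸ n`, by recursion on `n`. -/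
def subSym : PRSym 2 := PRSym.prec (PRSym.proj 0) (PRSym.comp predSym ![PRSym.proj 1])

/-- `0 ↦ 0` and `n + 1 ↦ 1`. -/
def sgSym : PRSym 1 := PRSym.prec PRSym.zero (PRSym.comp PRSym.succ ![PRSym.comp PRSym.zero ![]])

/-- The characteristic function of `<`: its value at `(n, t)` is `1` if and only if `n < t`. -/
def ltSym : PRSym 2 := PRSym.comp sgSym ![subSym]

namespace Formula

/-- The formula `s < t`, that is, `f(s, t) = 1` with the characteristic function `f` of `<`. -/
def lt (s t : PTerm) : Formula := eq (app ltSym ![s, t]) (succT zeroT)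

/-- `∀ n < t. A`; the bound variable does not occur in `t`. -/
def ball (t : PTerm) (A : Formula) : Formula := all (imp (lt (var 0) (liftT t)) A)

/-- `∃ n < t. A`; the bound variable does not occur in `t`. -/
def bex (t : PTerm) (A : Formula) : Formula := ex (and (lt (var 0) (liftT t)) A)

end Formula

/-- Formulas all of whose quantifiers are bounded (the `Σ⁰₀`-formulas). -/
inductive IsBounded : Formula → Prop
  | eq (s t : PTerm) : IsBounded (Formula.eq s t)
  | and {A B : Formula} : IsBounded A → IsBounded B → IsBounded (Formula.and A B)
  | or {A B : Formula} : IsBounded A → IsBounded B → IsBounded (Formula.or A B)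
  | imp {A B : Formula} : IsBounded A → IsBounded B → IsBounded (Formula.imp A B)
  | neg {A : Formula} : IsBounded A → IsBounded (Formula.neg A)
  | ball (t : PTerm) {A : Formula} : IsBounded A → IsBounded (Formula.ball t A)
  | bex (t : PTerm) {A : Formula} : IsBounded A → IsBounded (Formula.bex t A)

/-- `k` alternating quantifiers in front of `P`; the first one is `∃` if the flag is `true` and
`∀` if it is `false`. -/
def altPrefix : Bool → ℕ → Formula → Formula
  | _, 0, P => P
  | true, k + 1, P => Formula.ex (altPrefix false k P)
  | false, k + 1, P => Formula.all (altPrefix true k P)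

/-- The `Σ⁰ₖ`-formulas `∃ n₁ ∀ n₂ … P` with `P` bounded. -/
def SigmaF (k : ℕ) : Set Formula := {A | ∃ P, IsBounded P ∧ A = altPrefix true k P}

/-- The `Π⁰ₖ`-formulas `∀ n₁ ∃ n₂ … P` with `P` bounded. -/
def PiF (k : ℕ) : Set Formula := {A | ∃ P, IsBounded P ∧ A = altPrefix false k P}

/-- The scheme `A ∨ ¬A` for `A` in `C`. -/
def LEM (C : Set Formula) : Set Formula := {F | ∃ A ∈ C, F = Formula.or A (Formula.neg A)}

/-- The scheme `¬¬A → A` for `A` in `C`. -/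
def DNE (C : Set Formula) : Set Formula :=
  {F | ∃ A ∈ C, F = Formula.imp (Formula.neg (Formula.neg A)) A}

/-- The scheme `(A ↔ B) → (A ∨ ¬A)` for `A` in `Π⁰ₖ` and `B` in `Σ⁰ₖ`. -/
def DeltaLEM (k : ℕ) : Set Formula :=
  {F | ∃ A ∈ PiF k, ∃ B ∈ SigmaF k,
    F = Formula.imp (Formula.iff A B) (Formula.or A (Formula.neg A))}

/-- The scheme `(A ↔ B) → (B ∨ A^⊥)` for `A` in `Π⁰ₖ` and `B` in `Σ⁰ₖ`. -/
def FpDeltaLEM (k : ℕ) : Set Formula :=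
  {F | ∃ A ∈ PiF k, ∃ B ∈ SigmaF k,
    F = Formula.imp (Formula.iff A B) (Formula.or B A.dual)}

end HeytingArith

/-!
For a prenex formula `A = Q₁ … Qₖ P` with bounded matrix, let `A'` be the prenex formula with the
opposite quantifiers and the matrix `¬P`. The dual of `A'` is `A`, so `A` and `A'` contradict each
other intuitionistically (`dual_absurd`). Heyting arithmetic decides bounded formulas, by bounded
search (`bex_or_ball`, `or_dual_of_isBounded`); hence it also proves that `¬P` implies the dual of
`P`. Given `Σ⁰ₖ`-LEM, an induction on `k` yields `A ∨ A'` for `A` in `Σ⁰ₖ` or `Π⁰ₖ`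
(`Proves.or_altPrefix_neg`), and `Π⁰ₖ`-LEM follows.

The other ingredient is that for `k ≥ 1` a disjunction of two `Σ⁰ₖ`-formulas is equivalent in
Heyting arithmetic to a `Σ⁰ₖ`-formula (`exists_sigma_or`). No pairing function is needed: the parity
of the outermost number selects the disjunct, half of it is the witness, and since parity is
decidable the two matrices can share the remaining quantifiers. So `Σ⁰ₖ`-DNE also eliminates the
double negation of such disjunctions (`Proves.or_of_not_not`).

* `Σ⁰ₖ₊₁`-DNE gives `Σ⁰ₖ`-LEM by induction on `k`: with idle quantifiers `A ∨ A'` is a disjunction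
  of `Σ⁰ₖ₊₁`-formulas, and `¬A` implies `A'` by excluded middle one level below.
* Let `A ↔ B` with `A` in `Π⁰ₖ` and `B` in `Σ⁰ₖ`. Excluded middle one level below turns `¬A'` into
  `A`, hence into `B`; so `¬¬(B ∨ A')`, and `Σ⁰ₖ`-DNE proves `B ∨ A'`. Finally `A'` implies the dual
  of `A`, and the dual implies `¬A`.
* Conversely, to derive `¬¬B → B` for `B` in `Σ⁰ₖ`, the scheme `fpΔ⁰ₖ`-LEM is applied to `B'`, whose
  dual is `B`, and a false `Σ⁰ₖ`-formula: both are refutable under `¬¬B`.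
-/

namespace HeytingArith

open FirstOrder.Language (Term)
open Formula

/-! ### Substitution -/

/-- The substitution that raises every variable by one. -/
def shift (i : ℕ) : PTerm := var (i + 1)

/-- The substitution that puts `t` for the variable `0` and lowers the other variables by one. -/
def instSub (t : PTerm) : ℕ → PTerm
  | 0 => t
  | j + 1 => var j

/-- The substitution that puts `t` for the variable `0` and keeps the other variables. -/
def replaceZero (t : PTerm) : ℕ → PTerm
  | 0 => t
  | j + 1 => var (j + 1)

@[simp] lemma instSub_zero (t : PTerm) : instSub t 0 = t := rfl
@[simp] lemma instSub_succ (t : PTerm) (j : ℕ) : instSub t (j + 1) = var j := rfl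
@[simp] lemma replaceZero_zero (t : PTerm) : replaceZero t 0 = t := rfl
@[simp] lemma replaceZero_succ (t : PTerm) (j : ℕ) : replaceZero t (j + 1) = var (j + 1) := rfl
@[simp] lemma shift_apply (i : ℕ) : shift i = var (i + 1) := rfl

@[simp] lemma subst_var (σ : ℕ → PTerm) (i : ℕ) : Term.subst (var i) σ = σ i := rfl

@[simp] lemma subst_app {n : ℕ} (f : PRSym n) (ts : Fin n → PTerm) (σ : ℕ → PTerm) :
    Term.subst (app f ts) σ = app f (fun i => Term.subst (ts i) σ) := rfl

@[simp] lemma app_const_vec (f : PRSym 1) (s : PTerm) :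
    app f (fun _ => s) = app f ![s] := by
  congr 1; funext i; fin_cases i; rfl

@[simp] lemma app_subst_vec {f : PRSym 2} (s t : PTerm) (σ : ℕ → PTerm) :
    app f (fun i => Term.subst ((![s, t] : Fin 2 → PTerm) i) σ) =
      app f ![Term.subst s σ, Term.subst t σ] := by
  congr 1; funext i; fin_cases i <;> rfl

@[simp] lemma subst_zeroT (σ : ℕ → PTerm) : Term.subst zeroT σ = zeroT := by
  unfold zeroT
  rw [subst_app]
  congr 1
  exact Subsingleton.elim _ _

@[simp] lemma subst_succT (t : PTerm) (σ : ℕ → PTerm) :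
    Term.subst (succT t) σ = succT (Term.subst t σ) := by
  unfold succT; simp

lemma term_subst_subst (t : PTerm) (σ τ : ℕ → PTerm) :
    Term.subst (Term.subst t σ) τ = Term.subst t (fun i => Term.subst (σ i) τ) := by
  induction t with
  | var i => rfl
  | func f ts ih =>
    change Term.func f _ = Term.func f _
    congr 1
    funext i
    exact ih i

lemma term_subst_id (t : PTerm) : Term.subst t var = t := by
  induction t with
  | var i => rfl
  | func f ts ih =>
    change Term.func f _ = Term.func f _
    congr 1
    funext i
    exact ih i

lemma liftT_eq (t : PTerm) : liftT t = Term.subst t shift := by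
  induction t with
  | var i => rfl
  | func f ts ih =>
    change Term.func f _ = Term.func f _
    congr 1
    funext i
    exact ih i

namespace Formula

@[simp] lemma up_zero (σ : ℕ → PTerm) : up σ 0 = var 0 := rfl
@[simp] lemma up_succ (σ : ℕ → PTerm) (i : ℕ) : up σ (i + 1) = liftT (σ i) := rfl
@[simp] lemma up_one (σ : ℕ → PTerm) : up σ 1 = liftT (σ 0) := rfl

lemma up_var : up var = var := by
  funext i
  cases i <;> rfl

lemma up_comp (σ τ : ℕ → PTerm) :
    (fun i => Term.subst (up σ i) (up τ)) = up (fun i => Term.subst (σ i) τ) := by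
  funext i
  cases i with
  | zero => rfl
  | succ i => simp only [up_succ, liftT_eq, term_subst_subst, shift_apply, subst_var]

lemma subst_subst (A : Formula) (σ τ : ℕ → PTerm) :
    subst τ (subst σ A) = subst (fun i => Term.subst (σ i) τ) A := by
  induction A generalizing σ τ <;> simp_all [subst, term_subst_subst, up_comp]

lemma subst_var_eq (A : Formula) : subst var A = A := by
  induction A <;> simp_all [subst, term_subst_id, up_var]

lemma lift_eq (A : Formula) : A.lift = subst shift A := rfl

lemma inst_eq (A : Formula) (t : PTerm) : A.inst t = subst (instSub t) A := by
  unfold inst; congr 1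

lemma stepUp_eq (A : Formula) : A.stepUp = subst (replaceZero (succT (var 0))) A := by
  unfold stepUp; congr 1

/-- Two substitution instances of `A` agree if the substitutions agree pointwise. -/
lemma subst_congr {A : Formula} {σ τ : ℕ → PTerm} (h : ∀ i, σ i = τ i) :
    subst σ A = subst τ A := by
  rw [funext h]

@[simp] lemma lift_inst (A : Formula) (t : PTerm) : A.lift.inst t = A := by
  rw [lift_eq, inst_eq, subst_subst]
  exact subst_var_eq A

@[simp] lemma subst_up_shift_inst (A : Formula) : (subst (up shift) A).inst (var 0) = A := by
  rw [inst_eq, subst_subst]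
  refine (subst_congr fun i => ?_).trans (subst_var_eq A)
  cases i <;> rfl

@[simp] lemma lift_neg (A : Formula) : (neg A).lift = neg A.lift := rfl
@[simp] lemma lift_all (A : Formula) : (all A).lift = all (subst (up shift) A) := rfl
lemma altPrefix_subst (b : Bool) (k : ℕ) (P : Formula) (σ : ℕ → PTerm) :
    subst σ (altPrefix b k P) = altPrefix b k (subst (up^[k] σ) P) := by
  induction k generalizing b σ with
  | zero => cases b <;> rfl
  | succ k ih => cases b <;> simp [altPrefix, subst, ih]

lemma dual_altPrefix (b : Bool) (k : ℕ) (P : Formula) :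
    (altPrefix b k P).dual = altPrefix (!b) k P.dual := by
  induction k generalizing b with
  | zero => cases b <;> rfl
  | succ k ih => cases b <;> simp [altPrefix, dual, ih]

lemma subst_ball (σ : ℕ → PTerm) (t : PTerm) (A : Formula) :
    subst σ (ball t A) = ball (Term.subst t σ) (subst (up σ) A) := by
  simp [ball, lt, subst, liftT_eq, term_subst_subst]

lemma subst_bex (σ : ℕ → PTerm) (t : PTerm) (A : Formula) :
    subst σ (bex t A) = bex (Term.subst t σ) (subst (up σ) A) := by
  simp [bex, lt, subst, liftT_eq, term_subst_subst]

end Formula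

lemma IsBounded.subst {A : Formula} (h : IsBounded A) (σ : ℕ → PTerm) :
    IsBounded (Formula.subst σ A) := by
  induction h generalizing σ with
  | eq s t => exact .eq _ _
  | and _ _ ihA ihB => exact .and (ihA σ) (ihB σ)
  | or _ _ ihA ihB => exact .or (ihA σ) (ihB σ)
  | imp _ _ ihA ihB => exact .imp (ihA σ) (ihB σ)
  | neg _ ih => exact .neg (ih σ)
  | ball t _ ih => rw [subst_ball]; exact .ball _ (ih _)
  | bex t _ ih => rw [subst_bex]; exact .bex _ (ih _)

lemma altPrefix_true_mem_SigmaF {P : Formula} (h : IsBounded P) (k : ℕ) :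
    altPrefix true k P ∈ SigmaF k := ⟨P, h, rfl⟩

/-! ### Intuitionistic predicate logic -/

namespace Derives

variable {T : Set Formula} {Γ Δ : List Formula} {A B C D : Formula}

lemma weaken (h : Derives T Γ A) (hΓ : Γ ⊆ Δ) : Derives T Δ A := by
  induction h generalizing Δ with
  | ax h => exact ax h
  | hyp h => exact hyp (hΓ h)
  | andI _ _ ih₁ ih₂ => exact andI (ih₁ hΓ) (ih₂ hΓ)
  | andE₁ _ ih => exact andE₁ (ih hΓ)
  | andE₂ _ ih => exact andE₂ (ih hΓ)
  | orI₁ _ ih => exact orI₁ (ih hΓ)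
  | orI₂ _ ih => exact orI₂ (ih hΓ)
  | orE _ _ _ ih₁ ih₂ ih₃ =>
    exact orE (ih₁ hΓ) (ih₂ (List.cons_subset_cons _ hΓ)) (ih₃ (List.cons_subset_cons _ hΓ))
  | impI _ ih => exact impI (ih (List.cons_subset_cons _ hΓ))
  | impE _ _ ih₁ ih₂ => exact impE (ih₁ hΓ) (ih₂ hΓ)
  | negI _ _ ih₁ ih₂ =>
    exact negI (ih₁ (List.cons_subset_cons _ hΓ)) (ih₂ (List.cons_subset_cons _ hΓ))
  | negE _ _ ih₁ ih₂ => exact negE (ih₁ hΓ) (ih₂ hΓ)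
  | allI _ ih => exact allI (ih (List.map_subset _ hΓ))
  | allE t _ ih => exact allE t (ih hΓ)
  | exI t _ ih => exact exI t (ih hΓ)
  | exE _ _ ih₁ ih₂ => exact exE (ih₁ hΓ) (ih₂ (List.cons_subset_cons _ (List.map_subset _ hΓ)))

lemma of_nil (h : Derives T [] A) : Derives T Γ A := h.weaken (List.nil_subset _)

lemma wk (h : Derives T Γ A) : Derives T (B :: Γ) A := h.weaken (List.subset_cons_self _ _)

lemma cut (h : Derives T Γ A) (h' : Derives T (A :: Γ) B) : Derives T Γ B := impE (impI h') h

/-- The bound variable of a lifted universal hypothesis, instantiated by the eigenvariable. -/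
lemma all_lift_elim (h : Derives T Γ (all A).lift) : Derives T Γ A := by
  rw [lift_all] at h
  simpa using allE (var 0) h

lemma ex_lift_intro (h : Derives T Γ A) : Derives T Γ (ex A).lift :=
  exI (A := subst (up shift) A) (var 0) (by simpa using h)

lemma all_mono (h : Derives T (Γ.map lift) (imp A B)) : Derives T Γ (imp (all A) (all B)) :=
  impI (allI (impE h.wk (all_lift_elim (hyp (by simp)))))

lemma ex_mono (h : Derives T (Γ.map lift) (imp A B)) : Derives T Γ (imp (ex A) (ex B)) :=
  impI (exE (hyp (List.mem_cons_self))
    (ex_lift_intro (impE (h.weaken (by simp)) (hyp List.mem_cons_self))))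

lemma altPrefix_mono {b : Bool} {k : ℕ} {P Q : Formula}
    (h : Derives T ((List.map lift)^[k] Γ) (imp P Q)) :
    Derives T Γ (imp (altPrefix b k P) (altPrefix b k Q)) := by
  induction k generalizing b Γ with
  | zero => cases b <;> exact h
  | succ k ih =>
    cases b
    · exact all_mono (ih h)
    · exact ex_mono (ih h)

/-- An innermost quantifier over a variable that does not occur can be dropped. -/
lemma altPrefix_succ_lift_imp (b : Bool) (k : ℕ) (P : Formula) :
    Derives T Γ (imp (altPrefix b (k + 1) P.lift) (altPrefix b k P)) := by
  induction k generalizing b Γ with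
  | zero =>
    cases b
    · exact impI (by
        simpa [altPrefix] using allE (Γ := all P.lift :: Γ) zeroT (hyp List.mem_cons_self))
    · exact impI (exE (hyp List.mem_cons_self) (hyp List.mem_cons_self))
  | succ k ih =>
    cases b
    · exact all_mono (ih _)
    · exact ex_mono (ih _)

/-- An innermost quantifier over a variable that does not occur can be added. -/
lemma imp_altPrefix_succ_lift (b : Bool) (k : ℕ) (P : Formula) :
    Derives T Γ (imp (altPrefix b k P) (altPrefix b (k + 1) P.lift)) := by
  induction k generalizing b Γ with
  | zero =>
    cases b
    · exact impI (allI (hyp (by simp [altPrefix])))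
    · exact impI (exI zeroT (by simpa [altPrefix] using hyp List.mem_cons_self))
  | succ k ih =>
    cases b
    · exact all_mono (ih _)
    · exact ex_mono (ih _)

lemma or_neg_congr (h₁ : Derives T Γ (imp A B)) (h₂ : Derives T Γ (imp B A))
    (h : Derives T Γ (or A (neg A))) : Derives T Γ (or B (neg B)) :=
  orE h (orI₁ (impE h₁.wk (hyp List.mem_cons_self)))
    (orI₂ (negI (impE h₂.wk.wk (hyp List.mem_cons_self)) (hyp (by simp))))

lemma dne_congr (h₁ : Derives T Γ (imp A B)) (h₂ : Derives T Γ (imp B A))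
    (h : Derives T Γ (imp (neg (neg A)) A)) : Derives T Γ (imp (neg (neg B)) B) :=
  impI (impE h₁.wk (impE h.wk (negI (A := neg A) (B := B)
    (negE (A := neg B) (negI (A := B) (B := A) (impE h₂.wk.wk.wk (hyp (by simp))) (hyp (by simp)))
      (hyp (by simp)))
    (negI (A := B) (B := A) (impE h₂.wk.wk.wk (hyp (by simp))) (hyp (by simp))))))

/-- A formula and its dual contradict each other intuitionistically. -/
lemma dual_absurd_hyp (A : Formula) (hA : A ∈ Γ) (hD : A.dual ∈ Γ) : Derives T Γ C := by
  induction A generalizing Γ C with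
  | eq s t => exact negE (hyp hA) (hyp hD)
  | neg A _ => exact negE (hyp hD) (hyp hA)
  | and A B ihA ihB =>
    exact orE (hyp hD)
      (cut (A := A) (andE₁ (hyp (List.mem_cons_of_mem _ hA))) (ihA (by simp) (by simp)))
      (cut (A := B) (andE₂ (hyp (List.mem_cons_of_mem _ hA))) (ihB (by simp) (by simp)))
  | or A B ihA ihB =>
    exact orE (hyp hA)
      (cut (A := A.dual) (andE₁ (hyp (List.mem_cons_of_mem _ hD))) (ihA (by simp) (by simp)))
      (cut (A := B.dual) (andE₂ (hyp (List.mem_cons_of_mem _ hD))) (ihB (by simp) (by simp)))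
  | imp A B _ ihB =>
    exact cut (A := B.dual) (andE₂ (hyp hD))
      (cut (A := B) (wk (impE (hyp hA) (andE₁ (hyp hD)))) (ihB (by simp) (by simp)))
  | all A ih =>
    refine exE (hyp hD) (cut (A := A) (all_lift_elim (hyp ?_)) (ih (by simp) (by simp)))
    exact List.mem_cons_of_mem _ (List.mem_map_of_mem hA)
  | ex A ih =>
    refine exE (hyp hA) (cut (A := A.dual) (all_lift_elim (hyp ?_)) (ih (by simp) (by simp)))
    exact List.mem_cons_of_mem _ (List.mem_map_of_mem hD)

lemma dual_absurd (hA : Derives T Γ A) (hD : Derives T Γ A.dual) : Derives T Γ C :=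
  cut hA (cut hD.wk (dual_absurd_hyp A (by simp) (by simp)))

lemma dual_imp_neg (A : Formula) : Derives T Γ (imp A.dual (neg A)) :=
  impI (negI (A := A) (B := A) (hyp (by simp)) (dual_absurd_hyp A (by simp) (by simp)))

lemma or_symm (h : Derives T Γ (or A B)) : Derives T Γ (or B A) :=
  orE h (orI₂ (hyp List.mem_cons_self)) (orI₁ (hyp List.mem_cons_self))

end Derives

/-! ### Equality and recursion equations in Heyting arithmetic -/

/-- The theory `T` contains the axioms of Heyting arithmetic. -/
class ExtendsHA (T : Set Formula) : Prop where
  subset : HA ⊆ T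

instance (X : Set Formula) : ExtendsHA (HA ∪ X) := ⟨Set.subset_union_left⟩

@[simp] lemma liftT_subst_instSub (s t : PTerm) : Term.subst (liftT t) (instSub s) = t := by
  rw [liftT_eq, term_subst_subst]
  exact term_subst_id t

@[simp] lemma liftT_var (i : ℕ) : liftT (var i) = var (i + 1) := rfl
@[simp] lemma liftT_zeroT : liftT zeroT = zeroT := by simp [liftT_eq]
@[simp] lemma liftT_succT (t : PTerm) : liftT (succT t) = succT (liftT t) := by simp [liftT_eq]
@[simp] lemma Formula.subst_lt (s t : PTerm) (σ : ℕ → PTerm) :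
    subst σ (lt s t) = lt (Term.subst s σ) (Term.subst t σ) := by
  simp [lt, subst]

/-- The function that interchanges `0` and the positive numbers: `0 ↦ 1` and `n + 1 ↦ 0`. -/
def nsgSym : PRSym 1 :=
  PRSym.prec (PRSym.comp PRSym.succ ![PRSym.zero]) (PRSym.comp PRSym.zero ![])

/-- The parity of a number, `0` or `1`. -/
def parSym : PRSym 1 := PRSym.prec PRSym.zero (PRSym.comp nsgSym ![PRSym.proj 1])

/-- Addition, by recursion on the first argument. -/
def addSym : PRSym 2 := PRSym.prec (PRSym.proj 0) (PRSym.comp PRSym.succ ![PRSym.proj 1])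

/-- `n ↦ ⌊n / 2⌋`, by the recursion `⌊(n + 1) / 2⌋ = par n + ⌊n / 2⌋`. -/
def halfSym : PRSym 1 :=
  PRSym.prec PRSym.zero
    (PRSym.comp addSym ![PRSym.comp parSym ![PRSym.proj 0], PRSym.proj 1])

namespace Derives

variable {T : Set Formula} [ExtendsHA T] {Γ : List Formula} {r s t u v : PTerm}
  {A B C D : Formula}

lemma ha (h : HAAxiom A) : Derives T Γ A := ax (ExtendsHA.subset h)

lemma eq_refl (t : PTerm) : Derives T Γ (eq t t) := ha (.eqRefl t)

/-- Leibniz's law, for the position of the variable `0` in `A`. -/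
lemma eq_rewrite (A : Formula) (h : Derives T Γ (eq s t)) (hA : Derives T Γ (A.inst s)) :
    Derives T Γ (A.inst t) := impE (impE (ha (.eqSubst s t A)) h) hA

lemma eq_symm (h : Derives T Γ (eq s t)) : Derives T Γ (eq t s) := by
  have := eq_rewrite (eq (var 0) (liftT s)) h
  simp only [inst_eq, subst, subst_var, instSub_zero, liftT_subst_instSub] at this
  exact this (eq_refl s)

lemma eq_trans (h : Derives T Γ (eq r s)) (h' : Derives T Γ (eq s t)) :
    Derives T Γ (eq r t) := by
  have := eq_rewrite (eq (liftT r) (var 0)) h'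
  simp only [inst_eq, subst, subst_var, instSub_zero, liftT_subst_instSub] at this
  exact this h

lemma app_congr1 (f : PRSym 1) (h : Derives T Γ (eq s t)) :
    Derives T Γ (eq (app f ![s]) (app f ![t])) := by
  have := eq_rewrite (eq (app f ![liftT s]) (app f ![var 0])) h
  simp [inst_eq, subst] at this
  exact this (eq_refl _)

lemma app_congr2 (f : PRSym 2) (h : Derives T Γ (eq s t)) (h' : Derives T Γ (eq u v)) :
    Derives T Γ (eq (app f ![s, u]) (app f ![t, v])) := by
  have h₁ := eq_rewrite (eq (app f ![liftT s, liftT u]) (app f ![var 0, liftT u])) h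
  have h₂ := eq_rewrite (eq (app f ![liftT t, liftT u]) (app f ![liftT t, var 0])) h'
  simp [inst_eq, subst] at h₁ h₂
  exact eq_trans (h₁ (eq_refl _)) (h₂ (eq_refl _))

lemma succ_congr (h : Derives T Γ (eq s t)) : Derives T Γ (eq (succT s) (succT t)) :=
  app_congr1 PRSym.succ h

lemma comp1 {n : ℕ} (f : PRSym 1) (g : PRSym n) (ts : Fin n → PTerm) :
    Derives T Γ (eq (app (PRSym.comp f ![g]) ts) (app f ![app g ts])) := by
  have := ha (T := T) (Γ := Γ) (.compDef f ![g] ts)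
  simpa using this

lemma comp2 {n : ℕ} (f : PRSym 2) (g₁ g₂ : PRSym n) (ts : Fin n → PTerm) :
    Derives T Γ (eq (app (PRSym.comp f ![g₁, g₂]) ts) (app f ![app g₁ ts, app g₂ ts])) := by
  have := ha (T := T) (Γ := Γ) (.compDef f ![g₁, g₂] ts)
  rwa [show (fun j => app ((![g₁, g₂] : Fin 2 → PRSym n) j) ts) = ![app g₁ ts, app g₂ ts] by
    funext j; fin_cases j <;> rfl] at this

lemma comp_zero {n : ℕ} (ts : Fin n → PTerm) :
    Derives T Γ (eq (app (PRSym.comp PRSym.zero ![]) ts) zeroT) := by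
  have := ha (T := T) (Γ := Γ) (.compDef PRSym.zero ![] ts)
  rwa [Subsingleton.elim (fun j => app ((![] : Fin 0 → PRSym n) j) ts) ![]] at this

lemma app_zero (ts : Fin 0 → PTerm) : Derives T Γ (eq (app PRSym.zero ts) zeroT) := by
  rw [Subsingleton.elim ts ![]]; exact eq_refl _

lemma succ_ne_zero (h : Derives T Γ (eq (succT t) zeroT)) : Derives T Γ A := by
  have := allE t (ha (T := T) (Γ := Γ) .succNeZero)
  simp [inst_eq, subst] at this
  exact negE h this

lemma succ_inj (h : Derives T Γ (eq (succT s) (succT t))) : Derives T Γ (eq s t) := by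
  have := allE t (allE s (ha (T := T) (Γ := Γ) .succInj))
  simp [inst_eq, subst] at this
  exact impE this h

/-- Induction, as a rule. -/
lemma all_induction (h0 : Derives T Γ (A.inst zeroT))
    (hS : Derives T (A :: Γ.map lift) A.stepUp) : Derives T Γ (all A) :=
  impE (ha (.induction A)) (andI h0 (allI (impI hS)))

/-- Case distinction between zero and a successor. -/
lemma all_cases (h0 : Derives T Γ (A.inst zeroT))
    (hS : Derives T (Γ.map lift) A.stepUp) : Derives T Γ (all A) :=
  all_induction h0 hS.wk

lemma pred_zero : Derives T Γ (eq (app predSym ![zeroT]) zeroT) :=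
  ha (.precZero PRSym.zero (PRSym.proj 0) ![])

lemma pred_succ (t : PTerm) : Derives T Γ (eq (app predSym ![succT t]) t) :=
  eq_trans (ha (.precSucc PRSym.zero (PRSym.proj 0) t ![])) (ha (.projDef 0 _))

lemma zero_sub (t : PTerm) : Derives T Γ (eq (app subSym ![zeroT, t]) t) :=
  eq_trans (ha (.precZero (PRSym.proj 0) (PRSym.comp predSym ![PRSym.proj 1]) ![t]))
    (ha (.projDef 0 _))

lemma succ_sub (s t : PTerm) :
    Derives T Γ (eq (app subSym ![succT s, t]) (app predSym ![app subSym ![s, t]])) :=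
  eq_trans (ha (.precSucc (PRSym.proj 0) (PRSym.comp predSym ![PRSym.proj 1]) s ![t]))
    (eq_trans (comp1 _ _ _) (app_congr1 _ (ha (.projDef 1 _))))

lemma sg_zero : Derives T Γ (eq (app sgSym ![zeroT]) zeroT) :=
  ha (.precZero PRSym.zero _ ![])

lemma sg_succ (t : PTerm) : Derives T Γ (eq (app sgSym ![succT t]) (succT zeroT)) :=
  eq_trans (ha (.precSucc PRSym.zero _ t ![])) (eq_trans (comp1 _ _ _) (succ_congr (comp_zero _)))

lemma nsg_zero : Derives T Γ (eq (app nsgSym ![zeroT]) (succT zeroT)) :=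
  eq_trans (ha (.precZero _ _ ![])) (eq_trans (comp1 _ _ _) (succ_congr (app_zero _)))

lemma nsg_succ (t : PTerm) : Derives T Γ (eq (app nsgSym ![succT t]) zeroT) :=
  eq_trans (ha (.precSucc _ _ t ![])) (comp_zero _)

lemma par_zero : Derives T Γ (eq (app parSym ![zeroT]) zeroT) := ha (.precZero _ _ ![])

lemma par_succ (t : PTerm) :
    Derives T Γ (eq (app parSym ![succT t]) (app nsgSym ![app parSym ![t]])) :=
  eq_trans (ha (.precSucc _ _ t ![]))
    (eq_trans (comp1 _ _ _) (app_congr1 _ (ha (.projDef 1 _))))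

lemma zero_add (t : PTerm) : Derives T Γ (eq (app addSym ![zeroT, t]) t) :=
  eq_trans (ha (.precZero _ _ ![t])) (ha (.projDef 0 _))

lemma succ_add (s t : PTerm) :
    Derives T Γ (eq (app addSym ![succT s, t]) (succT (app addSym ![s, t]))) :=
  eq_trans (ha (.precSucc _ _ s ![t]))
    (eq_trans (comp1 _ _ _) (succ_congr (ha (.projDef 1 _))))

lemma half_zero : Derives T Γ (eq (app halfSym ![zeroT]) zeroT) := ha (.precZero _ _ ![])

lemma half_succ (t : PTerm) :
    Derives T Γ (eq (app halfSym ![succT t])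
      (app addSym ![app parSym ![t], app halfSym ![t]])) :=
  eq_trans (ha (.precSucc _ _ t ![]))
    (eq_trans (comp2 _ _ _ _) (app_congr2 _
      (eq_trans (comp1 _ _ _) (app_congr1 _ (ha (.projDef 0 _)))) (ha (.projDef 1 _))))

/-! ### Decidable equality and the order -/

/-- Equality is decidable, by induction on one side and case distinction on the other. -/
lemma eq_or_neg (s t : PTerm) : Derives T Γ (or (eq s t) (neg (eq s t))) := by
  have key : Derives T Γ
      (all (all (or (eq (var 1) (var 0)) (neg (eq (var 1) (var 0)))))) := by
    apply all_induction
    · simp only [inst_eq, subst, subst_var, up_zero, up_one, instSub_zero, liftT_zeroT]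
      apply all_cases
      · simp [inst_eq, subst]
        exact orI₁ (eq_refl _)
      · simp [stepUp_eq, subst]
        exact orI₂ (negI (A := eq zeroT (succT (var 0))) (B := eq zeroT zeroT) (eq_refl _)
          (succ_ne_zero (eq_symm (hyp List.mem_cons_self))))
    · simp only [stepUp_eq, subst, subst_var, up_zero, up_one, replaceZero_zero, liftT_succT,
        liftT_var]
      apply all_cases
      · simp [inst_eq, subst]
        exact orI₂ (negI (B := eq zeroT zeroT) (eq_refl _)
          (succ_ne_zero (hyp List.mem_cons_self)))
      · simp [stepUp_eq, subst]
        have ih : Derives T (Formula.lift (all (or (eq (var 1) (var 0)) (neg (eq (var 1) (var 0)))))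
            :: (Γ.map lift).map lift) _ := allE (var 0) (hyp List.mem_cons_self)
        simp [inst_eq, subst] at ih
        refine orE ih (orI₁ (succ_congr (hyp List.mem_cons_self)))
          (orI₂ (negI (succ_inj (hyp List.mem_cons_self)) (hyp (by simp))))
  have := allE t (allE s key)
  simpa [inst_eq, subst] using this

lemma lt_of_sub (h : Derives T Γ (eq (app subSym ![s, t]) (app subSym ![u, v])))
    (h' : Derives T Γ (lt s t)) : Derives T Γ (lt u v) :=
  eq_trans (comp1 _ _ _) (eq_trans (app_congr1 _ (eq_symm h))
    (eq_trans (eq_symm (comp1 _ _ _)) h'))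

end Derives

@[simp] lemma liftT_subst_replaceZero (s t : PTerm) :
    Term.subst (liftT t) (replaceZero s) = liftT t := by
  simp only [liftT_eq, term_subst_subst, shift_apply, subst_var, replaceZero_succ]
  rfl

namespace Derives

variable {T : Set Formula} [ExtendsHA T] {Γ : List Formula} {r s t u v : PTerm}
  {A B C D : Formula}

lemma sub_zero (t : PTerm) : Derives T Γ (eq (app subSym ![t, zeroT]) zeroT) := by
  have key : Derives T Γ (all (eq (app subSym ![var 0, zeroT]) zeroT)) := by
    apply all_induction
    · simpa [inst_eq, subst] using zero_sub zeroT
    · simp only [stepUp_eq, subst, subst_app, app_subst_vec, subst_var, replaceZero_zero,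
        subst_zeroT]
      exact eq_trans (succ_sub _ _) (eq_trans (app_congr1 _ (hyp List.mem_cons_self)) pred_zero)
  simpa [inst_eq, subst] using allE t key

lemma succ_sub_succ (s t : PTerm) :
    Derives T Γ (eq (app subSym ![succT s, succT t]) (app subSym ![s, t])) := by
  have key : Derives T Γ (all (eq (app subSym ![succT (var 0), succT (liftT t)])
      (app subSym ![var 0, liftT t]))) := by
    apply all_induction
    · simp [inst_eq, subst]
      exact eq_trans (succ_sub _ _) (eq_trans (app_congr1 _ (zero_sub _))
        (eq_trans (pred_succ _) (eq_symm (zero_sub _))))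
    · simp [stepUp_eq, subst]
      exact eq_trans (succ_sub _ _) (eq_trans (app_congr1 _ (hyp List.mem_cons_self))
        (eq_symm (succ_sub _ _)))
  simpa [inst_eq, subst] using allE s key

lemma not_lt_zero (h : Derives T Γ (lt t zeroT)) : Derives T Γ A :=
  succ_ne_zero (eq_trans (eq_symm h)
    (eq_trans (comp1 _ _ _) (eq_trans (app_congr1 _ (sub_zero t)) sg_zero)))

lemma zero_lt_succ (t : PTerm) : Derives T Γ (lt zeroT (succT t)) :=
  eq_trans (comp1 _ _ _) (eq_trans (app_congr1 _ (zero_sub _)) (sg_succ t))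

lemma succ_lt_succ (h : Derives T Γ (lt s t)) : Derives T Γ (lt (succT s) (succT t)) :=
  lt_of_sub (eq_symm (succ_sub_succ s t)) h

lemma lt_of_succ_lt_succ (h : Derives T Γ (lt (succT s) (succT t))) : Derives T Γ (lt s t) :=
  lt_of_sub (succ_sub_succ s t) h

lemma lt_succ_self (t : PTerm) : Derives T Γ (lt t (succT t)) := by
  have key : Derives T Γ (all (lt (var 0) (succT (var 0)))) := by
    apply all_induction
    · simpa [inst_eq] using zero_lt_succ zeroT
    · simpa [stepUp_eq] using succ_lt_succ (hyp List.mem_cons_self)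
  simpa [inst_eq] using allE t key

lemma lt_succ_of_lt (h : Derives T Γ (lt s t)) : Derives T Γ (lt s (succT t)) := by
  have key : Derives T Γ
      (all (all (imp (lt (var 0) (var 1)) (lt (var 0) (succT (var 1)))))) := by
    apply all_induction
    · simp [inst_eq, subst]
      exact allI (impI (not_lt_zero (hyp List.mem_cons_self)))
    · simp [stepUp_eq, subst]
      apply all_cases
      · simpa [inst_eq, subst] using impI (zero_lt_succ _)
      · simp [stepUp_eq, subst]
        have ih : Derives T
            (Formula.lift (all (imp (lt (var 0) (var 1)) (lt (var 0) (succT (var 1)))))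
            :: (Γ.map lift).map lift) _ := allE (var 0) (hyp List.mem_cons_self)
        simp [inst_eq, subst] at ih
        exact impI (succ_lt_succ (impE ih.wk (lt_of_succ_lt_succ (hyp List.mem_cons_self))))
  have := allE s (allE t key)
  simp [inst_eq, subst] at this
  exact impE this h

/-- By induction on `t`, for all `s` at once, with a case distinction on `s`. -/
lemma lt_or_eq_of_lt_succ (h : Derives T Γ (lt s (succT t))) :
    Derives T Γ (or (lt s t) (eq s t)) := by
  have key : Derives T Γ (all (all (imp (lt (var 0) (succT (var 1)))
      (or (lt (var 0) (var 1)) (eq (var 0) (var 1)))))) := by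
    apply all_induction
    · simp [inst_eq, subst]
      apply all_cases
      · simpa [inst_eq, subst] using impI (orI₂ (eq_refl _))
      · simp [stepUp_eq, subst]
        exact impI (not_lt_zero (lt_of_succ_lt_succ (hyp List.mem_cons_self)))
    · simp [stepUp_eq, subst]
      apply all_cases
      · simpa [inst_eq, subst] using impI (orI₁ (zero_lt_succ _))
      · simp [stepUp_eq, subst]
        have ih : Derives T (Formula.lift (all (imp (lt (var 0) (succT (var 1)))
            (or (lt (var 0) (var 1)) (eq (var 0) (var 1)))))
            :: (Γ.map lift).map lift) _ := allE (var 0) (hyp List.mem_cons_self)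
        simp [inst_eq, subst] at ih
        exact impI (orE (impE ih.wk (lt_of_succ_lt_succ (hyp List.mem_cons_self)))
          (orI₁ (succ_lt_succ (hyp List.mem_cons_self)))
          (orI₂ (succ_congr (hyp List.mem_cons_self))))
  have := allE s (allE t key)
  simp [inst_eq, subst] at this
  exact impE this h

/-! ### Bounded formulas -/

/-- Bounded search: if one of `B(n)` and `D(n)` holds for each `n`, then either `B(n)` for some
`n < t` or `D(n)` for all `n < t`. The proof is by induction on the bound. -/
lemma bex_or_ball (h : ∀ Γ, Derives T Γ (or B D)) (t : PTerm) :
    Derives T Γ (or (bex t B) (ball t D)) := by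
  -- `B'` and `D'` are `B` and `D` with the bound of the search inserted as variable `1`.
  set B' := subst (up shift) B with hB'
  set D' := subst (up shift) D with hD'
  have hup : ∀ (r : PTerm) (F : Formula), subst (up (instSub r)) (subst (up shift) F) = F := by
    intro r F
    rw [subst_subst, up_comp]
    refine (subst_congr fun i => ?_).trans (subst_var_eq F)
    cases i <;> rfl
  have hstep : ∀ (r : PTerm) (F : Formula),
      subst (up (replaceZero r)) (subst (up shift) F) = subst (up shift) F := by
    intro r F
    rw [subst_subst, up_comp]
    rfl
  have key : Derives T Γ (all (or (ex (and (lt (var 0) (var 1)) B'))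
      (all (imp (lt (var 0) (var 1)) D')))) := by
    apply all_induction
    · simp [inst_eq, subst]
      exact orI₂ (allI (impI (not_lt_zero (hyp List.mem_cons_self))))
    · simp only [stepUp_eq, subst, subst_lt, subst_var, up_zero, up_one, replaceZero_zero,
        liftT_succT, liftT_var, hB', hD', hstep]
      refine orE (hyp List.mem_cons_self) (orI₁ ?_) (orE (h _) (orI₁ ?_) (orI₂ ?_))
      · refine impE (ex_mono (impI (andI (lt_succ_of_lt ?_) ?_))) (hyp List.mem_cons_self)
        · exact andE₁ (hyp List.mem_cons_self)
        · exact andE₂ (hyp List.mem_cons_self)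
      · refine exI (var 0) ?_
        have e := subst_up_shift_inst B
        rw [inst_eq] at e
        simp only [inst_eq, subst, e, subst_lt, subst_var, instSub_zero, subst_succT]
        exact andI (lt_succ_self _) (hyp List.mem_cons_self)
      · refine allI (impI (orE (lt_or_eq_of_lt_succ (hyp List.mem_cons_self)) ?_ ?_))
        · refine impE (all_lift_elim (A := imp (lt (var 0) (var 1)) D') (hyp ?_))
            (hyp List.mem_cons_self)
          simp [hD']
        · -- `D` holds at the bound, and the two variables are equal.
          have e₁ : (subst (up (up shift)) (subst (up shift) D)).inst (var 1) = D.lift := by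
            rw [inst_eq, subst_subst, subst_subst, lift_eq]
            refine subst_congr fun i => ?_
            cases i <;> rfl
          have e₂ : (subst (up (up shift)) (subst (up shift) D)).inst (var 0) = D' := by
            rw [inst_eq, subst_subst, subst_subst, hD']
            refine subst_congr fun i => ?_
            cases i <;> rfl
          refine Eq.mp (congrArg (Derives T _) e₂)
            (eq_rewrite (s := var 1) _ (eq_symm (hyp List.mem_cons_self)) ?_)
          rw [e₁]
          exact hyp (by simp)
  have := allE t key
  simp only [inst_eq, subst, subst_lt, subst_var, up_zero, up_one, instSub_zero, hB', hD',
    hup] at this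
  exact this

/-- Heyting arithmetic decides bounded formulas, with the dual in place of the negation. -/
lemma or_dual_of_isBounded {P : Formula} (hP : IsBounded P) (Γ : List Formula) :
    Derives T Γ (or P P.dual) := by
  induction hP generalizing Γ with
  | eq s t => exact eq_or_neg s t
  | and _ _ ihA ihB =>
    exact orE (ihA _) (orE (ihB _) (orI₁ (andI (hyp (by simp)) (hyp (by simp))))
      (orI₂ (orI₂ (hyp (by simp))))) (orI₂ (orI₁ (hyp (by simp))))
  | or _ _ ihA ihB =>
    exact orE (ihA _) (orI₁ (orI₁ (hyp (by simp)))) (orE (ihB _) (orI₁ (orI₂ (hyp (by simp))))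
      (orI₂ (andI (hyp (by simp)) (hyp (by simp)))))
  | @imp A B _ _ ihA ihB =>
    exact orE (ihA _)
      (orE (ihB _) (orI₁ (impI (hyp (by simp)))) (orI₂ (andI (hyp (by simp)) (hyp (by simp)))))
      (orI₁ (impI (dual_absurd_hyp A (by simp) (by simp))))
  | @neg A _ ih =>
    exact orE (ih _) (orI₂ (hyp List.mem_cons_self)) (orI₁ (negI (A := A) (B := A) (hyp (by simp))
      (dual_absurd_hyp A (by simp) (by simp))))
  | ball t _ ih =>
    exact or_symm (bex_or_ball (fun Γ => or_symm (ih Γ)) t)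
  | bex t _ ih =>
    refine orE (bex_or_ball ih t) (orI₁ (hyp (by simp))) (orI₂ ?_)
    refine impE (all_mono (impI ?_)) (hyp List.mem_cons_self)
    exact orE (eq_or_neg _ _) (orI₂ (impE (hyp (by simp [lt])) (hyp List.mem_cons_self)))
      (orI₁ (hyp List.mem_cons_self))

lemma or_neg_of_isBounded {P : Formula} (hP : IsBounded P) (Γ : List Formula) :
    Derives T Γ (or P (neg P)) :=
  orE (or_dual_of_isBounded hP Γ) (orI₁ (hyp (by simp)))
    (orI₂ (impE (dual_imp_neg P) (hyp (by simp))))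

lemma neg_imp_dual_of_isBounded {P : Formula} (hP : IsBounded P) :
    Derives T Γ (imp (neg P) P.dual) :=
  impI (orE (or_dual_of_isBounded hP _) (negE (A := P) (hyp (by simp)) (hyp (by simp)))
    (hyp (by simp)))

end Derives

/-! ### Disjunctions of `Σ⁰ₖ`-formulas -/

lemma iterate_lift_neg (m : ℕ) (E : Formula) : lift^[m] (neg E) = neg (lift^[m] E) := by
  induction m generalizing E with
  | zero => rfl
  | succ m ih => exact ih E.lift

lemma IsBounded.iterate_lift {E : Formula} (h : IsBounded E) (m : ℕ) :
    IsBounded (lift^[m] E) := by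
  induction m generalizing E with
  | zero => exact h
  | succ m ih => exact ih (h.subst _)

lemma mem_iterate_map_lift {E : Formula} {Γ : List Formula} (h : E ∈ Γ) (m : ℕ) :
    lift^[m] E ∈ (List.map lift)^[m] Γ := by
  induction m generalizing E Γ with
  | zero => exact h
  | succ m ih => exact ih (List.mem_map_of_mem h)

/-- `P` if `E` holds and `Q` if it does not, where `P` and `Q` stand in the scope of `m`
quantifiers and `E` stands outside of it. -/
def caseSplit (m : ℕ) (E P Q : Formula) : Formula :=
  or (and (lift^[m] E) P) (and (neg (lift^[m] E)) Q)

/-- The number `t` is even. -/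
def evenF (t : PTerm) : Formula := eq (app parSym ![t]) zeroT

namespace Derives

section Logic

variable {T : Set Formula} {Γ : List Formula} {B C E P Q : Formula}

lemma caseSplit_imp_left (b : Bool) (m : ℕ) (h : E ∈ Γ) :
    Derives T Γ (imp (altPrefix b m (caseSplit m E P Q)) (altPrefix b m P)) :=
  altPrefix_mono (impI (orE (hyp List.mem_cons_self) (andE₂ (hyp List.mem_cons_self))
    (negE (hyp (List.mem_cons_of_mem _ (List.mem_cons_of_mem _ (mem_iterate_map_lift h m))))
      (andE₁ (hyp List.mem_cons_self)))))

lemma imp_caseSplit_left (b : Bool) (m : ℕ) (h : E ∈ Γ) :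
    Derives T Γ (imp (altPrefix b m P) (altPrefix b m (caseSplit m E P Q))) :=
  altPrefix_mono (impI (orI₁ (andI (hyp (List.mem_cons_of_mem _ (mem_iterate_map_lift h m)))
    (hyp List.mem_cons_self))))

lemma caseSplit_imp_right (b : Bool) (m : ℕ) (h : neg E ∈ Γ) :
    Derives T Γ (imp (altPrefix b m (caseSplit m E P Q)) (altPrefix b m Q)) := by
  have h' := mem_iterate_map_lift h m
  rw [iterate_lift_neg] at h'
  exact altPrefix_mono (impI (orE (hyp List.mem_cons_self)
    (negE (andE₁ (hyp List.mem_cons_self))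
      (hyp (List.mem_cons_of_mem _ (List.mem_cons_of_mem _ h'))))
    (andE₂ (hyp List.mem_cons_self))))

lemma imp_caseSplit_right (b : Bool) (m : ℕ) (h : neg E ∈ Γ) :
    Derives T Γ (imp (altPrefix b m Q) (altPrefix b m (caseSplit m E P Q))) := by
  have h' := mem_iterate_map_lift h m
  rw [iterate_lift_neg] at h'
  exact altPrefix_mono (impI (orI₂ (andI (hyp (List.mem_cons_of_mem _ h'))
    (hyp List.mem_cons_self))))

end Logic

variable {T : Set Formula} [ExtendsHA T] {Γ : List Formula} {B C D E P Q : Formula}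

lemma succ_even {s t : PTerm} (h : Derives T Γ (and (evenF t) (eq (app halfSym ![t]) s))) :
    Derives T Γ (and (eq (app parSym ![succT t]) (succT zeroT))
      (eq (app halfSym ![succT t]) s)) :=
  andI (eq_trans (par_succ t) (eq_trans (app_congr1 _ (andE₁ h)) nsg_zero))
    (eq_trans (half_succ t) (eq_trans (app_congr2 _ (andE₁ h) (andE₂ h)) (zero_add _)))

lemma succ_odd {s t : PTerm} (h : Derives T Γ (eq (app parSym ![t]) (succT zeroT)))
    (h' : Derives T Γ (eq (app halfSym ![t]) s)) :
    Derives T Γ (and (evenF (succT t)) (eq (app halfSym ![succT t]) (succT s))) :=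
  andI (eq_trans (par_succ t) (eq_trans (app_congr1 _ h) (nsg_succ _)))
    (eq_trans (half_succ t) (eq_trans (app_congr2 _ h h')
      (eq_trans (succ_add _ _) (succ_congr (zero_add _)))))

/-- Each number is the half of an even number. -/
lemma exists_even (t : PTerm) : Derives T Γ
    (ex (and (evenF (var 0)) (eq (app halfSym ![var 0]) (liftT t)))) := by
  have key : Derives T Γ
      (all (ex (and (evenF (var 0)) (eq (app halfSym ![var 0]) (var 1))))) := by
    apply all_induction
    · refine exI zeroT ?_
      simp [evenF, inst_eq, subst]
      exact andI par_zero half_zero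
    · simp only [stepUp_eq]
      refine exE (hyp List.mem_cons_self) (exI (succT (succT (var 0))) ?_)
      simp [evenF, inst_eq, subst]
      refine succ_odd (andE₁ (succ_even (s := var 1) ?_)) (andE₂ (succ_even ?_)) <;>
        exact hyp List.mem_cons_self
  simpa [evenF, inst_eq, subst] using allE t key

/-- Each number is the half, rounded down, of an odd number. -/
lemma exists_odd (t : PTerm) : Derives T Γ
    (ex (and (neg (evenF (var 0))) (eq (app halfSym ![var 0]) (liftT t)))) := by
  refine exE (exists_even t) (exI (succT (var 0)) ?_)
  have ht : Term.subst (Term.subst (liftT t) (up fun i => var (i + 1)))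
      (instSub (succT (var 0))) = liftT t := by
    simp only [liftT_eq, term_subst_subst]
    rfl
  simp only [evenF, inst_eq, subst, subst_app, app_const_vec, subst_var, up_zero,
    instSub_zero, subst_zeroT, Matrix.cons_val_fin_one, ht]
  have h := succ_even (T := T) (hyp (List.mem_cons_self (l := Γ.map lift)
    (a := and (evenF (var 0)) (eq (app halfSym ![var 0]) (liftT t)))))
  exact andI (negI (B := eq zeroT zeroT) (eq_refl _)
    (succ_ne_zero (eq_trans (eq_symm (andE₁ h).wk) (hyp List.mem_cons_self)))) (andE₂ h)

/-- A witness `x` of `B` is passed to `D` as a code `z` of half `x`, where `E(z)` tells that `z`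
is a code of the right kind. -/
lemma ex_imp_ex_of_half (hE : subst (up shift) E = E)
    (hcode : ∀ Γ, Derives T Γ (ex (and E (eq (app halfSym ![var 0]) (var 1)))))
    (h : ∀ Γ, Derives T Γ (imp E (imp (subst (replaceZero (app halfSym ![var 0])) B) D))) :
    Derives T Γ (imp (ex B) (ex D)) := by
  set F := imp E (imp (subst (replaceZero (app halfSym ![var 0])) B) D) with hF
  refine impI (cut (A := all F) (allI (h _)) ?_)
  refine exE (hyp (A := ex B) (by simp)) (exE (hcode _) ?_)
  refine ex_lift_intro (A := subst (up shift) D) ?_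
  -- `G(x)` is `B(x)` with the variables of the context raised past the code and the witness.
  set G := subst (up (up shift)) (subst (up shift) B) with hG
  have e₁ : G.inst (var 1) = B.lift := by
    rw [inst_eq, hG, subst_subst, subst_subst, lift_eq]
    refine subst_congr fun i => ?_
    cases i <;> rfl
  have e₂ : G.inst (app halfSym ![var 0]) =
      subst (up shift) (subst (replaceZero (app halfSym ![var 0])) B) := by
    rw [inst_eq, hG, subst_subst, subst_subst, subst_subst]
    refine subst_congr fun i => ?_
    cases i <;> simp
  have hx : Derives T (and E (eq (app halfSym ![var 0]) (var 1)) ::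
      List.map lift (B :: List.map lift (all F :: ex B :: Γ)))
      (subst (up shift) (subst (replaceZero (app halfSym ![var 0])) B)) := by
    rw [← e₂]
    refine eq_rewrite (s := var 1) _ (eq_symm (andE₂ (hyp List.mem_cons_self))) ?_
    rw [e₁]
    exact hyp (by simp)
  have hall : Derives T (and E (eq (app halfSym ![var 0]) (var 1)) ::
      List.map lift (B :: List.map lift (all F :: ex B :: Γ))) (subst (up shift) F) :=
    all_lift_elim (hyp (by simp))
  rw [hF] at hall
  simp only [subst, hE] at hall
  exact impE (impE hall (andE₁ (hyp List.mem_cons_self))) hx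

end Derives

open Derives

/-- In Heyting arithmetic the disjunction of two `Σ⁰ₘ₊₁`-formulas is a `Σ⁰ₘ₊₁`-formula: the
parity of the first quantified number selects the disjunct, and its half is the witness. -/
lemma exists_sigma_or (m : ℕ) {P Q : Formula} (hP : IsBounded P) (hQ : IsBounded Q) :
    ∃ C ∈ SigmaF (m + 1), ∀ (T : Set Formula) [ExtendsHA T] (Γ : List Formula),
      Derives T Γ (imp C (or (altPrefix true (m + 1) P) (altPrefix true (m + 1) Q))) ∧
      Derives T Γ (imp (altPrefix true (m + 1) P) C) ∧
      Derives T Γ (imp (altPrefix true (m + 1) Q) C) := by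
  set E := evenF (var 0) with hE
  set ρ := replaceZero (app halfSym ![var 0]) with hρ
  have hEb : IsBounded (lift^[m] E) := (IsBounded.eq _ _).iterate_lift m
  have hinst : ∀ F : Formula,
      (subst (up shift) F).inst (app halfSym ![var 0]) = subst ρ F := by
    intro F
    rw [inst_eq, subst_subst]
    refine subst_congr fun i => ?_
    cases i <;> rfl
  have hEs : subst (up shift) E = E := by simp [hE, evenF, subst]
  refine ⟨_, altPrefix_true_mem_SigmaF (P := caseSplit m E (subst (up^[m] ρ) P)
    (subst (up^[m] ρ) Q)) (.or (.and hEb (hP.subst _)) (.and (.neg hEb) (hQ.subst _))) (m + 1),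
    fun T _ Γ => ⟨?_, ?_, ?_⟩⟩
  · refine impI (exE (hyp List.mem_cons_self) ?_)
    refine orE (eq_or_neg (app parSym ![var 0]) zeroT)
      (orI₁ (exI (app halfSym ![var 0]) ?_)) (orI₂ (exI (app halfSym ![var 0]) ?_))
    · refine Eq.mp (congrArg (Derives T _) (hinst _).symm) ?_
      rw [altPrefix_subst]
      exact impE (caseSplit_imp_left false m List.mem_cons_self)
        (hyp (List.mem_cons_of_mem _ List.mem_cons_self))
    · refine Eq.mp (congrArg (Derives T _) (hinst _).symm) ?_
      rw [altPrefix_subst]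
      exact impE (caseSplit_imp_right false m List.mem_cons_self)
        (hyp (List.mem_cons_of_mem _ List.mem_cons_self))
  · refine ex_imp_ex_of_half hEs (fun Γ => exists_even (var 0)) fun Γ => impI ?_
    rw [altPrefix_subst]
    exact imp_caseSplit_left false m List.mem_cons_self
  · refine ex_imp_ex_of_half (E := neg E) (by simp [subst, hEs])
      (fun Γ => exists_odd (var 0)) fun Γ => impI ?_
    rw [altPrefix_subst]
    exact imp_caseSplit_right false m List.mem_cons_self

/-! ### The schemes -/

section Schemes

variable {T : Set Formula} {k : ℕ}

/-- An idle innermost quantifier turns a `Σ⁰ₖ`-formula into an equivalent `Σ⁰ₖ₊₁`-formula. -/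
lemma Proves.lem_of_succ (h : Proves T (LEM (SigmaF (k + 1)))) : Proves T (LEM (SigmaF k)) := by
  rintro _ ⟨_, ⟨P, hP, rfl⟩, rfl⟩
  exact or_neg_congr (altPrefix_succ_lift_imp true k P) (imp_altPrefix_succ_lift true k P)
    (h _ ⟨_, altPrefix_true_mem_SigmaF (hP.subst _) _, rfl⟩)

lemma Proves.dne_of_succ (h : Proves T (DNE (SigmaF (k + 1)))) : Proves T (DNE (SigmaF k)) := by
  rintro _ ⟨_, ⟨P, hP, rfl⟩, rfl⟩
  exact dne_congr (altPrefix_succ_lift_imp true k P) (imp_altPrefix_succ_lift true k P)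
    (h _ ⟨_, altPrefix_true_mem_SigmaF (hP.subst _) _, rfl⟩)

lemma Derives.all_of_neg_ex {B C : Formula} {Γ : List Formula}
    (h : ∀ Γ, Derives T Γ (or B C)) : Derives T Γ (imp (neg (ex B)) (all C)) :=
  impI (allI (orE (h _) (negE (ex_lift_intro (hyp List.mem_cons_self)) (hyp (by simp)))
    (hyp List.mem_cons_self)))

/-- `Σ⁰ₖ`-LEM decides between a formula of `Σ⁰ₖ` or `Π⁰ₖ` and the formula of the opposite class
in which all quantifiers of the prefix are interchanged and the matrix is negated. -/
lemma Proves.or_altPrefix_neg [ExtendsHA T] (h : Proves T (LEM (SigmaF k))) {P : Formula}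
    (hP : IsBounded P) (b : Bool) (Γ : List Formula) :
    Derives T Γ (or (altPrefix b k P) (altPrefix (!b) k (neg P))) := by
  induction k generalizing b Γ with
  | zero => cases b <;> exact or_neg_of_isBounded hP Γ
  | succ k ih =>
    cases b
    · refine or_symm (orE (of_nil (h _ ⟨_, altPrefix_true_mem_SigmaF hP.neg (k + 1), rfl⟩))
        (orI₁ (hyp List.mem_cons_self)) (orI₂ (impE (all_of_neg_ex fun Γ => ?_)
          (hyp List.mem_cons_self))))
      exact or_symm (ih h.lem_of_succ true Γ)
    · exact orE (of_nil (h _ ⟨_, altPrefix_true_mem_SigmaF hP (k + 1), rfl⟩))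
        (orI₁ (hyp List.mem_cons_self)) (orI₂ (impE (all_of_neg_ex (ih h.lem_of_succ false))
          (hyp List.mem_cons_self)))

lemma Derives.altPrefix_neg_absurd {b : Bool} {P C : Formula} {Γ : List Formula}
    (h : Derives T Γ (altPrefix b k P)) (h' : Derives T Γ (altPrefix (!b) k (neg P))) :
    Derives T Γ C :=
  dual_absurd h' (by simpa [dual_altPrefix, dual] using h)

/-- Double negation elimination for a `Σ⁰ₘ₊₁`-formula equivalent to `A ∨ B`. -/
lemma Proves.or_of_not_not [ExtendsHA T] {m : ℕ} (h : Proves T (DNE (SigmaF (m + 1))))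
    {P Q : Formula} (hP : IsBounded P) (hQ : IsBounded Q) {Γ : List Formula}
    (hPQ : ∀ C, Derives T
      (neg (altPrefix true (m + 1) Q) :: neg (altPrefix true (m + 1) P) :: Γ) C) :
    Derives T Γ (or (altPrefix true (m + 1) P) (altPrefix true (m + 1) Q)) := by
  obtain ⟨C, hC, hor⟩ := exists_sigma_or m hP hQ
  refine impE (hor T Γ).1 (impE (of_nil (h _ ⟨C, hC, rfl⟩)) ?_)
  have hn : ∀ (A : Formula) (Δ : List Formula), neg C ∈ Δ → Derives T (A :: Δ) (imp A C) →
      Derives T Δ (neg A) := fun A Δ hΔ hA =>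
    negI (B := C) (impE hA (hyp List.mem_cons_self)) (hyp (List.mem_cons_of_mem _ hΔ))
  have hF : ∀ F, Derives T (neg C :: Γ) F := fun F =>
    cut (hn (altPrefix true (m + 1) P) _ (by simp) (hor T _).2.1)
      (cut (hn (altPrefix true (m + 1) Q) _ (by simp) (hor T _).2.2)
        ((hPQ F).weaken (by intro x; simp; tauto)))
  exact negI (hF C) (hF _)

/-- By induction on `k`: for `A` in `Σ⁰ₖ`, the formula `A ∨ ¬A` amounts to a `Σ⁰ₖ₊₁`-formula, because
`¬A` is equivalent to a `Π⁰ₖ`-formula by the law of excluded middle one level below. -/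
lemma Proves.lem_of_dne_succ [ExtendsHA T] (h : Proves T (DNE (SigmaF (k + 1)))) :
    Proves T (LEM (SigmaF k)) := by
  induction k with
  | zero =>
    rintro _ ⟨_, ⟨P, hP, rfl⟩, rfl⟩
    exact or_neg_of_isBounded hP _
  | succ k ih =>
    rintro _ ⟨_, ⟨P, hP, rfl⟩, rfl⟩
    have hlem := ih h.dne_of_succ
    -- The prefix of `A` gets an idle innermost quantifier, that of `¬A` an idle outermost one.
    have hN : (all (altPrefix true k (neg P))).lift =
        altPrefix false (k + 1) (subst (up^[k + 1] shift) (neg P)) :=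
      altPrefix_subst false (k + 1) (neg P) shift
    refine orE (h.or_of_not_not (P := P.lift) (hP.subst _) (hP.neg.subst (up^[k + 1] shift))
      fun C => ?_) (orI₁ (impE (altPrefix_succ_lift_imp true (k + 1) P)
        (hyp List.mem_cons_self))) (orI₂ (negI (B := altPrefix true (k + 1) P)
          (hyp List.mem_cons_self) ?_))
    · refine negE (A := altPrefix true (k + 2) (subst (up^[k + 1] shift) (neg P))) ?_
        (hyp List.mem_cons_self)
      refine exI zeroT ?_
      rw [← hN, lift_inst]
      refine impE (all_of_neg_ex (hlem.or_altPrefix_neg hP false)) ?_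
      exact negI (B := altPrefix true (k + 2) P.lift)
        (impE (imp_altPrefix_succ_lift true (k + 1) P) (hyp List.mem_cons_self)) (hyp (by simp))
    · refine altPrefix_neg_absurd (b := true) (P := P) (k := k + 1) (hyp List.mem_cons_self) ?_
      refine exE (hyp (A := altPrefix true (k + 2) (subst (up^[k + 1] shift) (neg P)))
        (by simp)) (hyp ?_)
      rw [lift_eq, altPrefix_subst]
      simp

end Schemes

lemma proves_ax {X S : Set Formula} (h : S ⊆ X) : Proves X S := fun _ hA => ax (h hA)

/-- A prefix in front of the closed false equation `1 = 0` gives a contradiction. -/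
lemma Derives.altPrefix_false_elim {T : Set Formula} [ExtendsHA T] {C : Formula} (b : Bool)
    (k : ℕ) {Γ : List Formula} (h : Derives T Γ (altPrefix b k (eq (succT zeroT) zeroT))) :
    Derives T Γ C := by
  have hs : ∀ b k σ, subst σ (altPrefix b k (eq (succT zeroT) zeroT)) =
      altPrefix b k (eq (succT zeroT) zeroT) := by
    intro b k σ
    rw [altPrefix_subst]
    simp [subst]
  induction k generalizing b Γ C with
  | zero => cases b <;> exact succ_ne_zero h
  | succ k ih =>
    cases b
    · have := allE zeroT h
      rw [inst_eq, hs] at this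
      exact ih true this
    · exact exE h (ih false (hyp List.mem_cons_self))

lemma proves_lem_PiF {T : Set Formula} [ExtendsHA T] {k : ℕ} (h : Proves T (LEM (SigmaF k))) :
    Proves T (LEM (PiF k)) := by
  rintro _ ⟨_, ⟨P, hP, rfl⟩, rfl⟩
  exact orE (h.or_altPrefix_neg hP false []) (orI₁ (hyp List.mem_cons_self))
    (orI₂ (negI (B := altPrefix false k P) (hyp List.mem_cons_self)
      (altPrefix_neg_absurd (b := false) (P := P) (hyp List.mem_cons_self) (hyp (by simp)))))

lemma proves_dne_of_lem {T X : Set Formula} (h : Proves T (LEM X)) : Proves T (DNE X) := by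
  rintro _ ⟨A, hA, rfl⟩
  exact impI (orE (of_nil (h _ ⟨A, hA, rfl⟩)) (hyp List.mem_cons_self)
    (negE (A := neg A) (hyp List.mem_cons_self) (hyp (by simp))))

/-- An idle outermost quantifier turns a `Σ⁰ₖ`-formula into an equivalent `Π⁰ₖ₊₁`-formula. -/
lemma proves_lem_SigmaF_of_PiF_succ {T : Set Formula} {k : ℕ}
    (h : Proves T (LEM (PiF (k + 1)))) : Proves T (LEM (SigmaF k)) := by
  rintro _ ⟨_, ⟨P, hP, rfl⟩, rfl⟩
  have hA := h _ ⟨all (altPrefix true k P).lift, ⟨subst (up^[k] shift) P, hP.subst _, by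
    rw [lift_eq, altPrefix_subst]; rfl⟩, rfl⟩
  refine or_neg_congr (impI ?_) (impI (allI (hyp (by simp)))) hA
  simpa using allE (Γ := [all (altPrefix true k P).lift]) zeroT (hyp List.mem_cons_self)

/-- For `B` in `Σ⁰ₖ`, the scheme is applied to a `Π⁰ₖ`-formula `A` with dual `B` and to a false
`Σ⁰ₖ`-formula; `¬¬B` makes the two equivalent, since `A` contradicts `B`. -/
lemma proves_dne_of_fpDeltaLEM {T : Set Formula} [ExtendsHA T] {k : ℕ}
    (h : Proves T (FpDeltaLEM k)) : Proves T (DNE (SigmaF k)) := by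
  rintro _ ⟨_, ⟨P, hP, rfl⟩, rfl⟩
  have hF := h _ ⟨altPrefix false k (neg P), ⟨_, hP.neg, rfl⟩,
    altPrefix true k (eq (succT zeroT) zeroT), ⟨_, .eq _ _, rfl⟩, rfl⟩
  rw [dual_altPrefix] at hF
  refine impI (orE (impE (of_nil hF) (andI (impI ?_) (impI ?_)))
    (altPrefix_false_elim true k (hyp List.mem_cons_self)) (hyp List.mem_cons_self))
  · refine negE (A := neg (altPrefix true k P)) (negI (B := altPrefix true k P)
      (hyp List.mem_cons_self) ?_) (hyp (by simp))
    exact altPrefix_neg_absurd (b := true) (P := P) (hyp List.mem_cons_self) (hyp (by simp))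
  · exact altPrefix_false_elim true k (hyp List.mem_cons_self)

/-- `B ∨ A^⊥` amounts to a `Σ⁰ₖ`-formula; its double negation follows from `A ↔ B`, because the
law of excluded middle for the next lower level turns the negation of `A^⊥` into `A`. -/
lemma proves_fpDeltaLEM_of_dne {T : Set Formula} [ExtendsHA T] {k : ℕ}
    (h : Proves T (DNE (SigmaF k))) : Proves T (FpDeltaLEM k) := by
  rintro _ ⟨_, ⟨P, hP, rfl⟩, _, ⟨Q, hQ, rfl⟩, rfl⟩
  cases k with
  | zero =>
    exact impI (orE (or_dual_of_isBounded hP _)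
      (orI₁ (impE (andE₁ (hyp (List.mem_cons_of_mem _ List.mem_cons_self)))
        (hyp List.mem_cons_self))) (orI₂ (hyp List.mem_cons_self)))
  | succ m =>
    rw [dual_altPrefix]
    have hlem := h.lem_of_dne_succ
    refine impI (orE (h.or_of_not_not hQ hP.neg fun C => ?_) (orI₁ (hyp List.mem_cons_self))
      (orI₂ (impE (altPrefix_mono (neg_imp_dual_of_isBounded hP)) (hyp List.mem_cons_self))))
    refine negE (A := altPrefix true (m + 1) Q) (impE (andE₁ (hyp (A := iff _ _)
      (List.mem_cons_of_mem _ (List.mem_cons_of_mem _ List.mem_cons_self)))) ?_) (hyp (by simp))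
    exact impE (all_of_neg_ex fun Γ => or_symm (hlem.or_altPrefix_neg hP true Γ))
      (hyp List.mem_cons_self)

lemma proves_deltaLEM_of_fpDeltaLEM {T : Set Formula} {k : ℕ}
    (h : Proves T (FpDeltaLEM k)) : Proves T (DeltaLEM k) := by
  rintro _ ⟨A, hA, B, hB, rfl⟩
  refine impI (orE (impE (of_nil (h _ ⟨A, hA, B, hB, rfl⟩)) (hyp List.mem_cons_self))
    (orI₁ (impE (andE₂ (hyp (A := iff A B) (by simp))) (hyp List.mem_cons_self)))
    (orI₂ (impE (dual_imp_neg A) (hyp List.mem_cons_self))))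

end HeytingArith


theorem mainTheorem1 (k : ℕ) :
    HeytingArith.Proves (HeytingArith.HA ∪ HeytingArith.LEM (HeytingArith.SigmaF k))
      (HeytingArith.LEM (HeytingArith.PiF k)) ∧
    HeytingArith.Proves (HeytingArith.HA ∪ HeytingArith.DNE (HeytingArith.SigmaF (k + 1)))
      (HeytingArith.LEM (HeytingArith.SigmaF k)) ∧
    HeytingArith.Proves (HeytingArith.LEM (HeytingArith.SigmaF k))
      (HeytingArith.DNE (HeytingArith.SigmaF k)) ∧
    HeytingArith.Proves (HeytingArith.LEM (HeytingArith.PiF (k + 1)))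
      (HeytingArith.LEM (HeytingArith.SigmaF k)) ∧
    (HeytingArith.Proves (HeytingArith.HA ∪ HeytingArith.FpDeltaLEM k)
        (HeytingArith.DNE (HeytingArith.SigmaF k)) ∧
      HeytingArith.Proves (HeytingArith.HA ∪ HeytingArith.DNE (HeytingArith.SigmaF k))
        (HeytingArith.FpDeltaLEM k)) ∧
    HeytingArith.Proves (HeytingArith.HA ∪ HeytingArith.DNE (HeytingArith.SigmaF k))
      (HeytingArith.DeltaLEM k) := by
  open HeytingArith in
  exact ⟨proves_lem_PiF (proves_ax Set.subset_union_right),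
    Proves.lem_of_dne_succ (proves_ax Set.subset_union_right),
    proves_dne_of_lem (proves_ax subset_rfl),
    proves_lem_SigmaF_of_PiF_succ (proves_ax subset_rfl),
    ⟨proves_dne_of_fpDeltaLEM (proves_ax Set.subset_union_right),
      proves_fpDeltaLEM_of_dne (proves_ax Set.subset_union_right)⟩,
    proves_deltaLEM_of_fpDeltaLEM (proves_fpDeltaLEM_of_dne (proves_ax Set.subset_union_right))⟩
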